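/- A semigroup with topology (SGT) is a non-empty semigroup $S$ endowed with a (possibly non-Hausdorff) topology; no compatibility between the product and the topology is assumed. For $f\colon S\to\mathbb{R}$ and $s\in S$ put $f_s(t)=f(ts)$. Let $C_r(S)$ be the space, with the sup-norm, of all bounded continuous $f\colon S\to\mathbb{R}$ such that $f_s$ is continuous for every $s\in S$. Let $C_{norm}(S)$ [resp. $C_{weak}(S)$] be the (right invariant) subspace of all $f\in C_r(S)$ for which $s\mapsto f_s$ and, for every $t\in S$, $s\mapsto f_{st}$ are continuous from $S$ to $C_r(S)$ with its norm [resp. weak] topology. The SGT $S$ is weakly [resp. strongly] right amenable if there is a linear functional $\phi$ on $C_{norm}(S)$ [resp. $C_{weak}(S)$] such that $\inf f(S)\le\phi(f)\le\sup f(S)$ and $\phi(f_s)=\phi(f)$ for all $f$ in this space and all $s\in S$. Subsemigroups carry the subspace topology, and topological groups are Hausdorff. **Theorem.** (1) If an SGT $S$ contains a dense subsemigroup that is weakly [resp. strongly] right amenable, then $S$ itself is weakly [resp. strongly] right amenable. (2) Every dense subgroup of a weakly right amenable topological group is weakly right amenable. -/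

import Mathlib

open scoped BoundedContinuousFunction

/-!  A semigroup with topology is a type `S` with `[Semigroup S] [TopologicalSpace S]`; no
compatibility between the product and the topology is assumed. -/

namespace SemigroupWithTopology

section Defs

variable (S : Type*) [Semigroup S] [TopologicalSpace S]

/-- The space `C_r(S)` of all bounded continuous real functions `f` on `S` such that
`f_s : t ↦ f (t * s)` is continuous for every `s`. As a subspace of `C_b(S)` it carries the
sup-norm. -/
def Cr : Submodule ℝ (S →ᵇ ℝ) where
  carrier := {f | ∀ s : S, Continuous fun t : S => f (t * s)}
  add_mem' := fun hf hg s =>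
    (hf s).add (hg s)
  zero_mem' := fun _ =>
    (continuous_const : Continuous fun _ : S => (0 : ℝ))
  smul_mem' := fun c _ hf s =>
    (hf s).const_mul c

instance : ContinuousAdd (Cr S) :=
  inferInstanceAs (ContinuousAdd (Cr S).toAddSubmonoid)

variable {S}

/-- The right translation `f ↦ f_s`, `f_s t = f (t * s)`, as a linear map of `C_r(S)`. -/
noncomputable def translate (s : S) : Cr S →ₗ[ℝ] Cr S where
  toFun f :=
    ⟨BoundedContinuousFunction.ofNormedAddCommGroup (fun t => f.1 (t * s)) (f.2 s) ‖f.1‖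
        (fun t => f.1.norm_coe_le_norm (t * s)),
      fun r => by simpa [mul_assoc] using f.2 (r * s)⟩
  map_add' f g := by
    ext t
    rfl
  map_smul' c f := by
    ext t
    rfl

theorem translate_apply (s : S) (f : Cr S) (t : S) : (translate s f).1 t = f.1 (t * s) := rfl

theorem translate_translate (s t : S) (f : Cr S) :
    translate s (translate t f) = translate (s * t) f := by
  ext x
  simp [translate_apply, mul_assoc]

variable (S)

/-- The space `C_norm(S)` of all `f` in `C_r(S)` such that `s ↦ f_s` and, for all `t`,
`s ↦ f_{st}` are continuous in the norm topology of `C_r(S)`. -/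
noncomputable def Cnorm : Submodule ℝ (Cr S) where
  carrier := {f | (Continuous fun s : S => translate s f) ∧
    ∀ t : S, Continuous fun s : S => translate (s * t) f}
  add_mem' := fun {f g} hf hg =>
    ⟨by simpa only [map_add] using! hf.1.add hg.1,
      fun t => by simpa only [map_add] using! (hf.2 t).add (hg.2 t)⟩
  zero_mem' := ⟨by simpa using continuous_const, fun t => by simpa using continuous_const⟩
  smul_mem' := fun c f hf =>
    ⟨by simpa only [map_smul] using! hf.1.const_smul c,
      fun t => by simpa only [map_smul] using! (hf.2 t).const_smul c⟩

/-- The space `C_weak(S)` of all `f` in `C_r(S)` such that `s ↦ f_s` and, for all `t`,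
`s ↦ f_{st}` are continuous in the weak topology of `C_r(S)`. -/
noncomputable def Cweak : Submodule ℝ (Cr S) where
  carrier := {f | (Continuous fun s : S => toWeakSpace ℝ (Cr S) (translate s f)) ∧
    ∀ t : S, Continuous fun s : S => toWeakSpace ℝ (Cr S) (translate (s * t) f)}
  add_mem' := fun {f g} hf hg =>
    ⟨by simpa only [map_add] using! hf.1.add hg.1,
      fun t => by simpa only [map_add] using! (hf.2 t).add (hg.2 t)⟩
  zero_mem' := ⟨by simpa using continuous_const, fun t => by simpa using continuous_const⟩
  smul_mem' := fun c f hf =>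
    ⟨by simpa only [map_smul] using! hf.1.const_smul c,
      fun t => by simpa only [map_smul] using! (hf.2 t).const_smul c⟩

variable {S}

/-- A linear subspace `F` of `C_r(S)` is right invariant if `u_s ∈ F` for all `u ∈ F`, `s ∈ S`. -/
def IsRightInvariant (F : Submodule ℝ (Cr S)) : Prop :=
  ∀ u ∈ F, ∀ s : S, translate s u ∈ F

theorem isRightInvariant_Cnorm : IsRightInvariant (Cnorm S) := fun u hu s =>
  ⟨by simpa only [translate_translate] using hu.2 s,
    fun t => by simpa only [translate_translate, mul_assoc] using hu.2 (t * s)⟩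

theorem isRightInvariant_Cweak : IsRightInvariant (Cweak S) := fun u hu s =>
  ⟨by simpa only [translate_translate] using hu.2 s,
    fun t => by simpa only [translate_translate, mul_assoc] using hu.2 (t * s)⟩

/-- A mean on `F`: a linear functional `φ` with `inf f(S) ≤ φ f ≤ sup f(S)` for all `f ∈ F`
(`S` is non-empty and `f` is bounded, so these are genuine real numbers). -/
def IsMean {F : Submodule ℝ (Cr S)} (φ : F →ₗ[ℝ] ℝ) : Prop :=
  ∀ f : F, (⨅ s : S, f.1.1 s) ≤ φ f ∧ φ f ≤ ⨆ s : S, f.1.1 s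

/-- A mean `φ` on a right invariant subspace `F` is right invariant if `φ (f_s) = φ f`. -/
def IsRightInvariantMean {F : Submodule ℝ (Cr S)} (hF : IsRightInvariant F)
    (φ : F →ₗ[ℝ] ℝ) : Prop :=
  IsMean φ ∧ ∀ (f : F) (s : S), φ ⟨translate s f.1, hF f.1 f.2 s⟩ = φ f

variable (S)

/-- `S` is weakly right amenable: there is a right invariant mean on `C_norm(S)`. -/
def WeaklyRightAmenable : Prop :=
  ∃ φ : Cnorm S →ₗ[ℝ] ℝ, IsRightInvariantMean isRightInvariant_Cnorm φ

/-- `S` is strongly right amenable: there is a right invariant mean on `C_weak(S)`. -/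
def StronglyRightAmenable : Prop :=
  ∃ φ : Cweak S →ₗ[ℝ] ℝ, IsRightInvariantMean isRightInvariant_Cweak φ

end Defs

end SemigroupWithTopology

namespace SemigroupWithTopology

open Filter Topology

section Pullback

variable {S T F : Type*} [Semigroup S] [TopologicalSpace S] [Semigroup T] [TopologicalSpace T]
  [FunLike F T S] [MulHomClass F T S]

/-! (1) Restriction to a dense subsemigroup `T` turns a mean on `T` into a mean `ψ` on `S`,
invariant under translation by `T`. Since `|ψ f| ≤ ‖f‖`, Hahn–Banach extends `ψ` to all of `C_r(S)`,
so weak continuity of `s ↦ f_s` makes `s ↦ ψ(f_s)` continuous; being constant on `T`, it is constant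
on `S` (`exists_isRightInvariantMean_of_denseRange`).

(2) On a dense subgroup `H`, functions in `C_norm(H)` are uniformly continuous and extend to
`C_norm(G)` (`exists_mem_Cnorm_pullback_eq`). Restriction is thus a bijection, along which the mean
is transported. -/

theorem exists_strongDual_extending_of_abs_le_norm {V : Type*} [SeminormedAddCommGroup V]
    [NormedSpace ℝ V] (p : Submodule ℝ V) (ψ : p →ₗ[ℝ] ℝ) (hψ : ∀ x : p, |ψ x| ≤ ‖x.1‖) :
    ∃ g : StrongDual ℝ V, ∀ x : p, g x = ψ x :=
  let ⟨g, hg, _⟩ := _root_.exists_extension_norm_eq p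
    (ψ.mkContinuous 1 fun x => by simpa using hψ x)
  ⟨g, hg⟩

theorem abs_apply_le_norm (f : Cr S) (s : S) : |f.1 s| ≤ ‖f.1‖ :=
  f.1.norm_coe_le_norm s

theorem bddAbove_range (f : Cr S) : BddAbove (Set.range fun s => f.1 s) :=
  ⟨‖f.1‖, by rintro _ ⟨s, rfl⟩; exact (abs_le.1 (abs_apply_le_norm f s)).2⟩

theorem bddBelow_range (f : Cr S) : BddBelow (Set.range fun s => f.1 s) :=
  ⟨-‖f.1‖, by rintro _ ⟨s, rfl⟩; exact (abs_le.1 (abs_apply_le_norm f s)).1⟩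

theorem IsMean.abs_le_norm [Nonempty S] {E : Submodule ℝ (Cr S)} {φ : E →ₗ[ℝ] ℝ} (hφ : IsMean φ)
    (f : E) : |φ f| ≤ ‖f.1.1‖ :=
  abs_le.2
    ⟨(le_ciInf fun s => (abs_le.1 (abs_apply_le_norm f.1 s)).1).trans (hφ f).1,
      (hφ f).2.trans (ciSup_le fun s => (abs_le.1 (abs_apply_le_norm f.1 s)).2)⟩

/-- Composition with a continuous semigroup homomorphism `ι : T → S`, as a map from `C_r(S)` to
`C_r(T)`. -/
noncomputable def pullback (ι : F) (hι : Continuous ι) : Cr S →L[ℝ] Cr T where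
  toFun f := ⟨f.1.compContinuous ⟨ι, hι⟩, fun t => by
    change Continuous fun x => f.1 (ι (x * t))
    simpa only [map_mul] using! (f.2 (ι t)).comp hι⟩
  map_add' _ _ := rfl
  map_smul' _ _ := rfl
  cont := ((BoundedContinuousFunction.continuous_compContinuous ⟨ι, hι⟩).comp
    continuous_subtype_val).subtype_mk _

theorem pullback_apply (ι : F) (hι : Continuous ι) (f : Cr S) (t : T) :
    (pullback ι hι f).1 t = f.1 (ι t) := rfl

theorem pullback_translate (ι : F) (hι : Continuous ι) (f : Cr S) (t : T) :
    pullback ι hι (translate (ι t) f) = translate t (pullback ι hι f) := by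
  ext x
  simp [pullback_apply, translate_apply]

theorem pullback_mem_Cnorm (ι : F) (hι : Continuous ι) {f : Cr S} (hf : f ∈ Cnorm S) :
    pullback ι hι f ∈ Cnorm T := by
  refine ⟨?_, fun t => ?_⟩
  · simpa only [← pullback_translate] using!
      (pullback ι hι).continuous.comp (hf.1.comp hι)
  · simpa only [← pullback_translate, map_mul] using!
      (pullback ι hι).continuous.comp ((hf.2 (ι t)).comp hι)

/-- A bounded operator is also weak-to-weak continuous. -/
theorem pullback_mem_Cweak (ι : F) (hι : Continuous ι) {f : Cr S} (hf : f ∈ Cweak S) :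
    pullback ι hι f ∈ Cweak T := by
  refine ⟨?_, fun t => ?_⟩
  · simpa only [← pullback_translate] using!
      (WeakSpace.map (pullback ι hι)).continuous.comp (hf.1.comp hι)
  · simpa only [← pullback_translate, map_mul] using!
      (WeakSpace.map (pullback ι hι)).continuous.comp ((hf.2 (ι t)).comp hι)

/-- A right invariant mean pushes forward along a continuous homomorphism with dense range,
provided that the orbit maps `s ↦ f_s` are weakly continuous. -/
theorem exists_isRightInvariantMean_of_denseRange [Nonempty T] (ι : F) (hι : Continuous ι)
    (hd : DenseRange ι) {E : Submodule ℝ (Cr S)} {E' : Submodule ℝ (Cr T)}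
    (hE : IsRightInvariant E) (hE' : IsRightInvariant E')
    (hmap : ∀ f ∈ E, pullback ι hι f ∈ E')
    (hcont : ∀ f ∈ E, Continuous fun s : S => toWeakSpace ℝ (Cr S) (translate s f))
    {φ : E' →ₗ[ℝ] ℝ} (hφ : IsRightInvariantMean hE' φ) :
    ∃ ψ : E →ₗ[ℝ] ℝ, IsRightInvariantMean hE ψ := by
  have : Nonempty S := ‹Nonempty T›.map ι
  let ψ : E →ₗ[ℝ] ℝ := φ ∘ₗ (pullback ι hι).toLinearMap.restrict hmap
  have ψ_apply (f : E) : ψ f = φ ⟨pullback ι hι f.1, hmap f.1 f.2⟩ := rfl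
  have hψ : IsMean ψ := fun f => by
    obtain ⟨h₁, h₂⟩ := hφ.1 ⟨pullback ι hι f.1, hmap f.1 f.2⟩
    rw [ψ_apply]
    exact ⟨(le_ciInf fun t => ciInf_le (bddBelow_range f.1) (ι t)).trans h₁,
      h₂.trans (ciSup_le fun t => le_ciSup (bddAbove_range f.1) (ι t))⟩
  refine ⟨ψ, hψ, fun f s => ?_⟩
  -- The weak topology in `hcont` is tested by functionals on all of `C_r(S)`, whereas `ψ` lives
  -- only on `E`.
  obtain ⟨g, hg⟩ := exists_strongDual_extending_of_abs_le_norm (V := Cr S) E ψ hψ.abs_le_norm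
  have hgc : Continuous fun s : S => g (translate s f.1) :=
    (WeakBilin.eval_continuous (topDualPairing ℝ (Cr S)).flip g).comp (hcont f.1 f.2)
  have hgψ (s : S) : g (translate s f.1) = ψ ⟨translate s f.1, hE f.1 f.2 s⟩ :=
    hg ⟨translate s f.1, hE f.1 f.2 s⟩
  rw [← hgψ]
  refine congrFun (hd.equalizer hgc continuous_const (funext fun t => ?_)) s
  change g (translate (ι t) f.1) = ψ f
  rw [hgψ, ψ_apply, ψ_apply]
  refine Eq.trans ?_ (hφ.2 ⟨pullback ι hι f.1, hmap f.1 f.2⟩ t)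
  congr 2
  exact pullback_translate ι hι f.1 t

theorem WeaklyRightAmenable.of_denseRange [Nonempty T] (ι : F) (hι : Continuous ι)
    (hd : DenseRange ι) (h : WeaklyRightAmenable T) : WeaklyRightAmenable S :=
  let ⟨_, hφ⟩ := h
  exists_isRightInvariantMean_of_denseRange ι hι hd _ _ (fun _ => pullback_mem_Cnorm ι hι)
    (fun _ hf => (toWeakSpaceCLM ℝ (Cr S)).continuous.comp hf.1) hφ

theorem StronglyRightAmenable.of_denseRange [Nonempty T] (ι : F) (hι : Continuous ι)
    (hd : DenseRange ι) (h : StronglyRightAmenable T) : StronglyRightAmenable S :=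
  let ⟨_, hφ⟩ := h
  exists_isRightInvariantMean_of_denseRange ι hι hd _ _ (fun _ => pullback_mem_Cweak ι hι)
    (fun _ hf => hf.1) hφ

theorem pullback_injective (ι : F) (hι : Continuous ι) (hd : DenseRange ι) :
    Function.Injective (pullback ι hι) := fun f g hfg => by
  refine Subtype.ext (DFunLike.coe_injective ?_)
  refine hd.equalizer f.1.continuous g.1.continuous (funext fun t => ?_)
  exact DFunLike.congr_fun (congrArg Subtype.val hfg) t

end Pullback

section Group

variable {G H : Type*} [Group G] [TopologicalSpace G] [Group H] [TopologicalSpace H]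

/-- Sup-norm continuity of the orbit map at `1` is uniform continuity: one `V` serves all `t`. -/
theorem exists_isOpen_forall_abs_sub_lt (ι : H →* G) (hι : IsDenseInducing ι) {f : Cr H}
    (hf : f ∈ Cnorm H) {ε : ℝ} (hε : 0 < ε) :
    ∃ V : Set G, IsOpen V ∧ 1 ∈ V ∧ ∀ u : H, ι u ∈ V → ∀ t, |f.1 (t * u) - f.1 t| < ε := by
  have h := Metric.tendsto_nhds.1 (hf.1.tendsto 1) ε hε
  rw [hι.isInducing.nhds_eq_comap, map_one, eventually_comap] at h
  obtain ⟨V, hV, hVo, h1⟩ := eventually_nhds_iff.1 h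
  refine ⟨V, hVo, h1, fun u hu t => ?_⟩
  have := hV _ hu u rfl
  refine lt_of_le_of_lt ?_ this
  simpa [translate_apply, Real.dist_eq] using!
    BoundedContinuousFunction.dist_coe_le_dist (f := (translate u f).1) (g := (translate 1 f).1) t

variable [IsTopologicalGroup G]

theorem exists_tendsto_comap_nhds (ι : H →* G) (hι : IsDenseInducing ι) {f : Cr H}
    (hf : f ∈ Cnorm H) (g : G) : ∃ c, Tendsto f.1 (comap ι (𝓝 g)) (𝓝 c) := by
  have := hι.comap_nhds_neBot g
  refine CompleteSpace.complete (Metric.cauchy_iff.2 ⟨inferInstance, fun ε hε => ?_⟩)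
  obtain ⟨V, hVo, h1, hV⟩ := exists_isOpen_forall_abs_sub_lt ι hι hf hε
  have hc : Tendsto (fun p : G × G => p.1⁻¹ * p.2) (𝓝 g ×ˢ 𝓝 g) (𝓝 1) := by
    have : Continuous fun p : G × G => p.1⁻¹ * p.2 := by fun_prop
    simpa [nhds_prod_eq] using this.tendsto (g, g)
  obtain ⟨W, hW, hWV⟩ := mem_prod_same_iff.1 (hc (hVo.mem_nhds h1))
  refine ⟨f.1 '' (ι ⁻¹' W), image_mem_map (preimage_mem_comap hW), ?_⟩
  rintro _ ⟨x, hx, rfl⟩ _ ⟨y, hy, rfl⟩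
  -- Since `y = x * (x⁻¹ * y)`, the uniform estimate compares `f x` with `f y`.
  have := hV (x⁻¹ * y) (by simpa using hWV (Set.mk_mem_prod hx hy)) x
  rwa [mul_inv_cancel_left, ← Real.dist_eq, dist_comm] at this

/-- Functions in `C_norm` extend along dense inducing homomorphisms into topological groups. -/
theorem exists_mem_Cnorm_pullback_eq (ι : H →* G) (hι : IsDenseInducing ι) {f : Cr H}
    (hf : f ∈ Cnorm H) : ∃ k ∈ Cnorm G, pullback ι hι.continuous k = f := by
  have hlim := exists_tendsto_comap_nhds ι hι hf
  set k : G → ℝ := hι.extend f.1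
  have hkc : Continuous k := hι.continuous_extend hlim
  have hkι (t : H) : k (ι t) = f.1 t := hι.extend_eq f.1.continuous t
  have hkb (x : G) : ‖k x‖ ≤ ‖f.1‖ :=
    hι.dense.induction_on x (isClosed_le hkc.norm continuous_const) fun t => by
      rw [hkι]; exact abs_apply_le_norm f t
  let K : Cr G := ⟨BoundedContinuousFunction.ofNormedAddCommGroup k hkc ‖f.1‖ hkb,
    fun s => hkc.comp (continuous_mul_const s)⟩
  have hK : Continuous fun s : G => translate s K := by
    refine continuous_iff_continuousAt.2 fun s₀ => Metric.tendsto_nhds.2 fun ε hε => ?_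
    obtain ⟨V, hVo, h1, hV⟩ := exists_isOpen_forall_abs_sub_lt ι hι hf (half_pos hε)
    -- The estimate passes from `H` to `G` by density, in `v` and in `x`; limits only keep `≤`,
    -- hence `ε / 2`.
    have key (v : G) (hv : v ∈ V) (x : G) : |k (x * v) - k x| ≤ ε / 2 := by
      have hcl : IsClosed {v | |k (x * v) - k x| ≤ ε / 2} :=
        isClosed_le ((hkc.comp (continuous_const_mul x)).sub continuous_const).abs continuous_const
      refine closure_minimal ?_ hcl (hι.dense.open_subset_closure_inter hVo hv)
      rintro _ ⟨hu, u, rfl⟩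
      refine hι.dense.induction_on x (isClosed_le
        ((hkc.comp (continuous_mul_const _)).sub hkc).abs continuous_const) fun t => ?_
      change |k (ι t * ι u) - k (ι t)| ≤ ε / 2
      rw [← map_mul, hkι, hkι]
      exact (hV u hu t).le
    have hs : Tendsto (fun s => s₀⁻¹ * s) (𝓝 s₀) (𝓝 1) := by
      simpa using (continuous_const_mul s₀⁻¹).tendsto s₀
    filter_upwards [hs (hVo.mem_nhds h1)] with s hsV
    refine lt_of_le_of_lt ((BoundedContinuousFunction.dist_le (half_pos hε).le).2 fun t => ?_)
      (half_lt_self hε)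
    change |k (t * s) - k (t * s₀)| ≤ ε / 2
    -- Here `t * s = (t * s₀) * (s₀⁻¹ * s)`.
    simpa [mul_assoc] using key _ hsV (t * s₀)
  refine ⟨K, ⟨hK, fun t => hK.comp (continuous_mul_const t)⟩, ?_⟩
  ext t
  exact hkι t

theorem WeaklyRightAmenable.of_isDenseInducing (ι : H →* G) (hι : IsDenseInducing ι)
    (h : WeaklyRightAmenable G) : WeaklyRightAmenable H := by
  obtain ⟨φ, hφ, hinv⟩ := h
  let e : Cnorm G ≃ₗ[ℝ] Cnorm H := LinearEquiv.ofBijective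
    ((pullback ι hι.continuous).toLinearMap.restrict fun _ => pullback_mem_Cnorm ι hι.continuous)
    ⟨fun f g hfg => Subtype.ext
        (pullback_injective ι hι.continuous hι.dense (congrArg Subtype.val hfg)),
      fun f => let ⟨k, hk, hkf⟩ := exists_mem_Cnorm_pullback_eq ι hι f.2
        ⟨⟨k, hk⟩, Subtype.ext hkf⟩⟩
  have he (k : Cnorm G) (t : H) : (e k).1.1 t = k.1.1 (ι t) := rfl
  refine ⟨φ ∘ₗ e.symm.toLinearMap, fun f => ?_, fun f s => ?_⟩
  · obtain ⟨k, rfl⟩ := e.surjective f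
    simp only [LinearMap.comp_apply, LinearEquiv.coe_coe, LinearEquiv.symm_apply_apply]
    -- By density, bounds for `k` on `H` remain bounds on `G`.
    refine ⟨(le_ciInf fun x => ?_).trans (hφ k).1, (hφ k).2.trans (ciSup_le fun x => ?_)⟩
    · exact hι.dense.induction_on x (isClosed_le continuous_const k.1.1.continuous)
        fun t => ciInf_le (bddBelow_range (e k).1) t
    · exact hι.dense.induction_on x (isClosed_le k.1.1.continuous continuous_const)
        fun t => le_ciSup (bddAbove_range (e k).1) t
  · obtain ⟨k, rfl⟩ := e.surjective f
    have : (⟨translate s (e k).1, isRightInvariant_Cnorm _ (e k).2 s⟩ : Cnorm H) =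
        e ⟨translate (ι s) k.1, isRightInvariant_Cnorm _ k.2 (ι s)⟩ :=
      Subtype.ext (pullback_translate ι hι.continuous k.1 s).symm
    rw [this]
    simpa using hinv k (ι s)

end Group

end SemigroupWithTopology

theorem mainTheorem11 :
    (∀ (S : Type*) [Semigroup S] [TopologicalSpace S] [Nonempty S] (T : Subsemigroup S),
      Dense (T : Set S) →
        (SemigroupWithTopology.WeaklyRightAmenable T →
          SemigroupWithTopology.WeaklyRightAmenable S) ∧
        (SemigroupWithTopology.StronglyRightAmenable T →
          SemigroupWithTopology.StronglyRightAmenable S)) ∧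
    (∀ (G : Type*) [Group G] [TopologicalSpace G] [IsTopologicalGroup G] [T2Space G]
      (H : Subgroup G), Dense (H : Set G) →
        SemigroupWithTopology.WeaklyRightAmenable G →
          SemigroupWithTopology.WeaklyRightAmenable H) := by
  refine ⟨fun S _ _ _ T hT => ?_, fun G _ _ _ _ H hH h => ?_⟩
  · have : Nonempty T := hT.nonempty.to_subtype
    have hd : DenseRange (MulMemClass.subtype T) := hT.denseRange_val
    exact ⟨.of_denseRange _ continuous_subtype_val hd,
      .of_denseRange _ continuous_subtype_val hd⟩
  · exact .of_isDenseInducing H.subtype hH.isDenseInducing_val h
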